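/- Let $X$ be a real or complex Banach space, let $1<\alpha<2$, and for $\beta>0$, $t>0$ put $g_\beta(t)=t^{\beta-1}/\Gamma(\beta)$ and $(g_\beta*f)(t)=\int_0^t g_\beta(t-s)f(s)\,ds$. Let $A$ be a closed, densely defined linear operator on $X$, and let $\{S_\alpha(t)\}_{t\ge 0}\subset B(X)$ be an $\alpha$-times resolvent family generated by $A$, that is: (a) $S_\alpha(\cdot)$ is strongly continuous on $[0,\infty)$ and $S_\alpha(0)=I$; (b) $S_\alpha(t)D(A)\subset D(A)$ and $AS_\alpha(t)x=S_\alpha(t)Ax$ for all $x\in D(A)$, $t\ge 0$; (c) $S_\alpha(t)x=x+\int_0^t g_\alpha(t-s)S_\alpha(s)Ax\,ds$ for all $x\in D(A)$, $t\ge 0$. Define $$P_\alpha(t)x=(g_{\alpha-1}*S_\alpha)(t)x=\int_0^t g_{\alpha-1}(t-s)S_\alpha(s)x\,ds\qquad(x\in X,\ t\ge 0).$$ Let $r>0$ and suppose that $S_\alpha(\cdot)$ is of bounded semivariation on $[0,r]$, that is, $$\sup\Big\{\Big\|\sum_{i=1}^n[S_\alpha(d_i)-S_\alpha(d_{i-1})]x_i\Big\|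 : n\ge 1,\ 0=d_0<d_1<\dots<d_n=r,\ x_i\in X,\ \|x_i\|\le 1\Big\}<\infty.$$ Then for every $t\in[0,r]$ the range of $P_\alpha(t)$ is contained in $D(A)$, the operator $AP_\alpha(t)$ is a bounded linear operator on $X$, and $\sup_{t\in[0,r]}\|t\,AP_\alpha(t)\|<\infty$. -/

import Mathlib

open Set
open scoped ENNReal

noncomputable section

namespace FractionalResolvent

/-- The kernel `g_β(t) = t^(β-1) / Γ(β)`, used for `β > 0` and `t > 0`. -/
def fracKernel (β t : ℝ) : ℝ := t ^ (β - 1) / Real.Gamma β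

/-- The convolution `(g_β * f)(t) = ∫_0^t g_β(t-s) f(s) ds`. -/
def fracConv {X : Type*} [NormedAddCommGroup X] [NormedSpace ℝ X]
    (β : ℝ) (f : ℝ → X) (t : ℝ) : X :=
  ∫ s in (0 : ℝ)..t, fracKernel β (t - s) • f s

/-- `S` (of which only the values at `t ≥ 0` matter) is an `α`-times resolvent family generated by
the closed, densely defined linear operator `A`. -/
structure IsResolventFamily {𝕜 X : Type*} [RCLike 𝕜] [NormedAddCommGroup X] [NormedSpace 𝕜 X]
    [NormedSpace ℝ X] (α : ℝ) (A : X →ₗ.[𝕜] X) (S : ℝ → X →L[𝕜] X) : Prop where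
  isClosed : A.IsClosed
  dense_domain : Dense (A.domain : Set X)
  strongly_continuous : ∀ x : X, ContinuousOn (fun t => S t x) (Ici 0)
  map_zero : S 0 = ContinuousLinearMap.id 𝕜 X
  commute : ∀ t : ℝ, 0 ≤ t → ∀ x : A.domain,
    ∃ h : S t (x : X) ∈ A.domain, A ⟨S t (x : X), h⟩ = S t (A x)
  resolvent_eq : ∀ x : A.domain, ∀ t : ℝ, 0 ≤ t →
    S t (x : X) = (x : X) + fracConv α (fun s => S s (A x)) t

/-- The operators `P_α(t) x = (g_{α-1} * S)(t) x`. -/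
def resolventP {𝕜 X : Type*} [RCLike 𝕜] [NormedAddCommGroup X] [NormedSpace 𝕜 X]
    [NormedSpace ℝ X] (α : ℝ) (S : ℝ → X →L[𝕜] X) (t : ℝ) (x : X) : X :=
  fracConv (α - 1) (fun s => S s x) t

/-- A subdivision `a = d_0 < d_1 < ⋯ < d_n = b` (the values `pt i` for `i > n` play no role). -/
structure Subdivision (a b : ℝ) where
  n : ℕ
  pt : ℕ → ℝ
  pt_zero : pt 0 = a
  pt_last : pt n = b
  pt_lt : ∀ i, i < n → pt i < pt (i + 1)

/-- `SV_d[G]`, the supremum of `‖∑ (G(d_{i+1}) - G(d_i)) x_i‖` over all `x_i` in the closed unit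
ball. -/
def semivariationOn {𝕜 X : Type*} [RCLike 𝕜] [NormedAddCommGroup X] [NormedSpace 𝕜 X]
    {a b : ℝ} (G : ℝ → X →L[𝕜] X) (d : Subdivision a b) : ℝ≥0∞ :=
  ⨆ (x : ℕ → X) (_ : ∀ i, ‖x i‖ ≤ 1),
    ‖∑ i ∈ Finset.range d.n, (G (d.pt (i + 1)) - G (d.pt i)) (x i)‖ₑ

/-- The semivariation `SV[G]` on `[a, b]`. -/
def semivariation {𝕜 X : Type*} [RCLike 𝕜] [NormedAddCommGroup X] [NormedSpace 𝕜 X]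
    (G : ℝ → X →L[𝕜] X) (a b : ℝ) : ℝ≥0∞ :=
  ⨆ d : Subdivision a b, semivariationOn G d

/-- `G` is of bounded semivariation on `[a, b]`. -/
def HasBoundedSemivariation {𝕜 X : Type*} [RCLike 𝕜] [NormedAddCommGroup X] [NormedSpace 𝕜 X]
    (G : ℝ → X →L[𝕜] X) (a b : ℝ) : Prop :=
  semivariation G a b < ⊤

end FractionalResolvent

end

open MeasureTheory Filter Topology

namespace FractionalResolvent

/-! ### Convolution on `[0, t]` with a locally integrable, possibly singular kernel -/

section Volterra

variable {E : Type*} [NormedAddCommGroup E] [NormedSpace ℝ E]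

/-! Two facts carry the proof. The first is `t P(t) = α (P * S)(t)`. Formally, the Laplace
transforms of `P` and `S` are `(λ^α - A)⁻¹` and `λ^(α-1) (λ^α - A)⁻¹`, and the identity is the
derivative in `λ` of the first. Here no transform is used: for `x ∈ D(A)` both sides solve the
Volterra equation `w = α ∫ P x + g_α * A w`, whose solution is unique (`eq_zero_of_eq_fracConv`),
and density of `D(A)` gives the rest (`smul_resolventP_eq_conv`).

The second is `A ∫_a^b P(u) x du = S(b) x - S(a) x`. Hence, for continuous `g`, `A` sends
Riemann-type approximations of `∫ P(u) g(u) du` to Stieltjes sums of `∫ dS(u) g(u)`. Bounded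
semivariation makes these sums Cauchy and bounds them by `C sup ‖g‖`; closedness of `A` passes to
the limit (`integral_resolventP_apply_mem_graph`).

Taking `g(u) = S(t - u) x` puts `(P * S)(t) x` in `D(A)`, with the bound `‖t A P(t)‖ ≤ α C M`, where
`M` bounds `‖S‖` on `[0, r]`. -/

theorem integral_triangle_swap {φ : ℝ → ℝ → E} {t : ℝ} (ht : 0 ≤ t)
    (hφ : IntegrableOn (Function.uncurry φ) (Icc 0 t ×ˢ Icc 0 t)) :
    ∫ s in (0 : ℝ)..t, ∫ u in (0 : ℝ)..s, φ s u = ∫ u in (0 : ℝ)..t, ∫ s in u..t, φ s u := by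
  have hφ' : IntegrableOn (Function.uncurry φ) (Ioc 0 t ×ˢ Ioc 0 t) :=
    hφ.mono_set (prod_mono Ioc_subset_Icc_self Ioc_subset_Icc_self)
  rw [IntegrableOn, Measure.volume_eq_prod, ← Measure.prod_restrict] at hφ'
  have hm : MeasurableSet {p : ℝ × ℝ | p.2 < p.1} :=
    measurableSet_lt measurable_snd measurable_fst
  have hψ := hφ'.indicator hm
  have key := integral_integral_swap
    (f := fun s u => {p : ℝ × ℝ | p.2 < p.1}.indicator (Function.uncurry φ) (s, u)) hψ
  rw [intervalIntegral.integral_of_le ht, intervalIntegral.integral_of_le ht]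
  convert key using 1
  · refine setIntegral_congr_fun measurableSet_Ioc fun s hs => ?_
    have h1 : (fun u => {p : ℝ × ℝ | p.2 < p.1}.indicator (Function.uncurry φ) (s, u))
        = (Iio s).indicator (φ s) := by
      ext u; by_cases h : u < s <;> simp [indicator, h]
    have h2 : Ioc 0 t ∩ Iio s = Ioo 0 s := by
      ext u; simp only [mem_inter_iff, mem_Ioc, mem_Iio, mem_Ioo]
      exact ⟨fun h => ⟨h.1.1, h.2⟩, fun h => ⟨⟨h.1, h.2.le.trans hs.2⟩, h.2⟩⟩
    simp only [h1]
    rw [setIntegral_indicator measurableSet_Iio, h2, intervalIntegral.integral_of_le hs.1.le,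
      integral_Ioc_eq_integral_Ioo]
  · refine setIntegral_congr_fun measurableSet_Ioc fun u hu => ?_
    have h1 : (fun s => {p : ℝ × ℝ | p.2 < p.1}.indicator (Function.uncurry φ) (s, u))
        = (Ioi u).indicator (fun s => φ s u) := by
      ext s; by_cases h : u < s <;> simp [indicator, h]
    have h2 : Ioc 0 t ∩ Ioi u = Ioc u t := by
      ext s; simp only [mem_inter_iff, mem_Ioc, mem_Ioi]
      exact ⟨fun h => ⟨h.2, h.1.2⟩, fun h => ⟨⟨hu.1.trans h.1, h.2⟩, h.1⟩⟩
    simp only [h1]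
    rw [setIntegral_indicator measurableSet_Ioi, h2, intervalIntegral.integral_of_le hu.2]

/-- The kernel may blow up on the diagonal, so continuity is no help: joint integrability is that of
a convolution integrand, after cutting both factors off to bounded intervals. -/
theorem integrableOn_kernel_sub_smul {k : ℝ → ℝ} (hk : ∀ a b, IntervalIntegrable k volume a b)
    {G : ℝ × ℝ → E} (hG : Continuous G) {t : ℝ} (ht : 0 ≤ t) :
    IntegrableOn (fun p : ℝ × ℝ => k (p.1 - p.2) • G p) (Icc 0 t ×ˢ Icc 0 t) := by
  refine IntegrableOn.smul_continuousOn ?_ hG.continuousOn (isCompact_Icc.prod isCompact_Icc)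
  have h1 : Integrable ((Icc 0 t).indicator (fun _ => (1 : ℝ))) :=
    (integrable_indicator_iff measurableSet_Icc).2 (by simp)
  have h2 : Integrable ((Icc (-t) t).indicator k) :=
    (integrable_indicator_iff measurableSet_Icc).2
      ((intervalIntegrable_iff_integrableOn_Icc_of_le (by linarith)).1 (hk _ _))
  have h3 := (h1.convolution_integrand (ContinuousLinearMap.mul ℝ ℝ) h2).integrableOn
    (s := Icc 0 t ×ˢ Icc 0 t)
  refine h3.congr_fun (fun p hp => ?_) (measurableSet_Icc.prod measurableSet_Icc)
  obtain ⟨⟨h1, h2⟩, h3, h4⟩ := hp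
  have : p.1 - p.2 ∈ Icc (-t) t := ⟨by linarith, by linarith⟩
  have h5 : p.2 ∈ Icc 0 t := ⟨h3, h4⟩
  simp [indicator_of_mem this, indicator_of_mem h5]

theorem integrableOn_kernel_fst_smul {k : ℝ → ℝ} (hk : ∀ a b, IntervalIntegrable k volume a b)
    {G : ℝ × ℝ → E} (hG : Continuous G) {t : ℝ} (ht : 0 ≤ t) :
    IntegrableOn (fun p : ℝ × ℝ => k (t - p.1) • G p) (Icc 0 t ×ˢ Icc 0 t) := by
  refine IntegrableOn.smul_continuousOn ?_ hG.continuousOn (isCompact_Icc.prod isCompact_Icc)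
  have h2 : IntegrableOn (fun s => k (t - s)) (Icc 0 t) := by
    have := (hk t 0).comp_sub_left t
    simp only [sub_self, sub_zero] at this
    exact (intervalIntegrable_iff_integrableOn_Icc_of_le ht).1 this
  rw [IntegrableOn, Measure.volume_eq_prod, ← Measure.prod_restrict]
  exact h2.comp_fst (volume.restrict (Icc 0 t))

theorem intervalIntegrable_kernel_smul {k : ℝ → ℝ} (hk : ∀ a b, IntervalIntegrable k volume a b)
    {f : ℝ → E} (hf : Continuous f) (t a b : ℝ) :
    IntervalIntegrable (fun s => k (t - s) • f s) volume a b := by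
  have := (hk (t - a) (t - b)).comp_sub_left t
  simp only [sub_sub_cancel] at this
  exact this.smul_continuousOn hf.continuousOn

theorem integral_kernel_comm (k : ℝ → ℝ) (f : ℝ → E) (t : ℝ) :
    ∫ s in (0 : ℝ)..t, k (t - s) • f s = ∫ s in (0 : ℝ)..t, k s • f (t - s) := by
  have := intervalIntegral.integral_comp_sub_left (a := 0) (b := t)
    (fun s => k s • f (t - s)) t
  simpa using this

/-- Once the variable is moved off the singular factor, `t` enters only through `f` and the upper
limit, and dominated convergence applies. -/
theorem continuous_kernel_integral {k : ℝ → ℝ} (hk : ∀ a b, IntervalIntegrable k volume a b)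
    {f : ℝ → E} (hf : Continuous f) :
    Continuous fun t => ∫ s in (0 : ℝ)..t, k (t - s) • f s := by
  simp only [integral_kernel_comm]
  rw [continuous_iff_continuousAt]
  intro t₀
  have hc : IsCompact ((fun p : ℝ × ℝ => f (p.1 - p.2)) ''
      (Icc (t₀ - 1) (t₀ + 1) ×ˢ Icc (-|t₀| - 1) (|t₀| + 1))) :=
    (isCompact_Icc.prod isCompact_Icc).image (by fun_prop)
  obtain ⟨C, hC⟩ := hc.isBounded.exists_norm_le
  have hle : -|t₀| - 1 ≤ |t₀| + 1 := by linarith [abs_nonneg t₀]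
  have key := intervalIntegral.continuousAt_parametric_primitive_of_dominated
    (μ := volume) (F := fun t s => k s • f (t - s)) (fun s => ‖k s‖ * C)
    (-|t₀| - 1) (|t₀| + 1) (a₀ := 0) (b₀ := t₀) (x₀ := t₀) ?_ ?_ ?_ ?_ ?_ ?_ ?_
  · exact key.comp (f := fun t : ℝ => (t, t)) (by fun_prop)
  · intro t
    exact ((hk _ _).smul_continuousOn (f := k) (g := fun s => f (t - s))
      (by fun_prop)).def'.aestronglyMeasurable
  · filter_upwards [Icc_mem_nhds (show t₀ - 1 < t₀ by linarith) (show t₀ < t₀ + 1 by linarith)]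
      with t ht
    refine (ae_restrict_iff' measurableSet_uIoc).2 (Eventually.of_forall fun s hs => ?_)
    rw [uIoc_of_le hle] at hs
    rw [norm_smul]
    exact mul_le_mul_of_nonneg_left
      (hC _ ⟨(t, s), ⟨ht, Ioc_subset_Icc_self hs⟩, rfl⟩) (norm_nonneg _)
  · exact (hk _ _).norm.mul_const C
  · exact Eventually.of_forall fun s => by fun_prop
  · exact ⟨by linarith [abs_nonneg t₀], by linarith [abs_nonneg t₀]⟩
  · exact ⟨by linarith [neg_abs_le t₀], by linarith [le_abs_self t₀]⟩
  · simp

end Volterra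

/-! ### Strongly continuous operator families, closed graphs and convolutions -/

section Operators

variable {𝕜 X : Type*} [RCLike 𝕜] [NormedAddCommGroup X] [NormedSpace 𝕜 X]

theorem exists_norm_le_of_strongly_continuous [CompleteSpace X] {F : ℝ → X →L[𝕜] X}
    (hF : ∀ x, Continuous fun t => F t x) (a b : ℝ) :
    ∃ C, ∀ t ∈ Icc a b, ‖F t‖ ≤ C := by
  obtain ⟨C, hC⟩ := banach_steinhaus (g := fun t : Icc a b => F t) (fun x => by
    obtain ⟨C, hC⟩ := (isCompact_Icc (a := a) (b := b)).exists_bound_of_continuousOn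
      (hF x).continuousOn
    exact ⟨C, fun t => hC t t.2⟩)
  exact ⟨C, fun t ht => hC ⟨t, ht⟩⟩

/-- Joint continuity follows from the local uniform bound supplied by Banach–Steinhaus. -/
theorem continuous_uncurry_of_strongly_continuous [CompleteSpace X] {F : ℝ → X →L[𝕜] X}
    (hF : ∀ x, Continuous fun t => F t x) : Continuous fun p : ℝ × X => F p.1 p.2 := by
  rw [continuous_iff_continuousAt]
  rintro ⟨t₀, x₀⟩
  obtain ⟨C, hC⟩ := exists_norm_le_of_strongly_continuous hF (t₀ - 1) (t₀ + 1)
  rw [ContinuousAt, tendsto_iff_norm_sub_tendsto_zero]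
  have hlim : Tendsto (fun p : ℝ × X => C * ‖p.2 - x₀‖ + ‖F p.1 x₀ - F t₀ x₀‖) (𝓝 (t₀, x₀))
      (𝓝 0) := by
    have h1 : Continuous fun p : ℝ × X => C * ‖p.2 - x₀‖ + ‖F p.1 x₀ - F t₀ x₀‖ := by
      have := (hF x₀).comp (continuous_fst (X := ℝ) (Y := X))
      exact ((continuous_snd.sub continuous_const).norm.const_mul C).add
        (this.sub continuous_const).norm
    simpa using h1.tendsto (t₀, x₀)
  refine squeeze_zero' (Eventually.of_forall fun p => norm_nonneg _) ?_ hlim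
  have h1 : ∀ᶠ p : ℝ × X in 𝓝 (t₀, x₀), p.1 ∈ Icc (t₀ - 1) (t₀ + 1) :=
    continuous_fst.continuousAt.eventually_mem
      (Icc_mem_nhds (show t₀ - 1 < t₀ by linarith) (show t₀ < t₀ + 1 by linarith))
  filter_upwards [h1] with p hp
  calc ‖F p.1 p.2 - F t₀ x₀‖ = ‖F p.1 (p.2 - x₀) + (F p.1 x₀ - F t₀ x₀)‖ := by
        rw [map_sub]; congr 1; abel
    _ ≤ ‖F p.1 (p.2 - x₀)‖ + ‖F p.1 x₀ - F t₀ x₀‖ := norm_add_le _ _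
    _ ≤ _ := by gcongr; exact (F p.1).le_of_opNorm_le (hC _ hp) _

variable [NormedSpace ℝ X] [IsScalarTower ℝ 𝕜 X]

omit [IsScalarTower ℝ 𝕜 X] in
theorem integral_mem_of_isClosed [CompleteSpace X] {V : Submodule 𝕜 X} (hV : IsClosed (V : Set X))
    {f : ℝ → X} {a b : ℝ} (hab : a ≤ b) (hf : ∀ s ∈ Icc a b, f s ∈ V) :
    ∫ s in a..b, f s ∈ V := by
  by_cases hi : IntervalIntegrable f volume a b
  · have : IsClosed (V : Set X) := hV
    -- The integral commutes with the quotient map, which kills the integrand; closedness of `V`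
    -- makes the quotient normed.
    let Q : X →L[𝕜] X ⧸ V := V.mkQL
    let _ : NormedSpace ℝ (X ⧸ V) := NormedSpace.restrictScalars ℝ 𝕜 _
    have h := Q.intervalIntegral_comp_comm hi
    have h0 : ∫ s in a..b, Q (f s) = 0 := by
      rw [intervalIntegral.integral_congr (g := fun _ => 0)]
      · simp
      · intro s hs
        rw [uIcc_of_le hab] at hs
        exact (Submodule.Quotient.mk_eq_zero V).2 (hf s hs)
    rw [h0] at h
    exact (Submodule.Quotient.mk_eq_zero V).1 h.symm
  · rw [intervalIntegral.integral_undef hi]; exact V.zero_mem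

omit [IsScalarTower ℝ 𝕜 X] in
theorem integral_mem_graph_of_isClosed [CompleteSpace X] {A : X →ₗ.[𝕜] X} (hA : A.IsClosed)
    {f g : ℝ → X} {a b : ℝ} (hab : a ≤ b) (hf : IntervalIntegrable f volume a b)
    (hg : IntervalIntegrable g volume a b) (h : ∀ s ∈ Icc a b, (f s, g s) ∈ A.graph) :
    (∫ s in a..b, f s, ∫ s in a..b, g s) ∈ A.graph := by
  have := integral_mem_of_isClosed (𝕜 := 𝕜) (X := X × X) (V := A.graph) hA hab h
  convert this using 1
  have hfg : IntervalIntegrable (fun s => (f s, g s)) volume a b :=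
    ⟨hf.1.prodMk hg.1, hf.2.prodMk hg.2⟩
  ext
  · exact (ContinuousLinearMap.fst ℝ X X).intervalIntegral_comp_comm hfg
  · exact (ContinuousLinearMap.snd ℝ X X).intervalIntegral_comp_comm hfg

theorem operator_conv_kernel_conv [CompleteSpace X] {k : ℝ → ℝ}
    (hk : ∀ a b, IntervalIntegrable k volume a b)
    {F : ℝ → X →L[𝕜] X} (hF : ∀ x, Continuous fun t => F t x) {h : ℝ → X} (hh : Continuous h)
    {t : ℝ} (ht : 0 ≤ t) :
    ∫ s in (0 : ℝ)..t, F (t - s) (∫ u in (0 : ℝ)..s, k (s - u) • h u) =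
      ∫ u in (0 : ℝ)..t, ∫ s in u..t, k (s - u) • F (t - s) (h u) := by
  have hF' := continuous_uncurry_of_strongly_continuous hF
  have hc : Continuous fun p : ℝ × ℝ => F (t - p.1) (h p.2) :=
    hF'.comp (f := fun p : ℝ × ℝ => (t - p.1, h p.2)) (by fun_prop)
  rw [← integral_triangle_swap ht (φ := fun s u => k (s - u) • F (t - s) (h u))
    (integrableOn_kernel_sub_smul hk hc ht)]
  refine intervalIntegral.integral_congr fun s _ => ?_
  rw [← ContinuousLinearMap.intervalIntegral_comp_comm _
    (intervalIntegrable_kernel_smul hk hh s 0 s)]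
  exact intervalIntegral.integral_congr fun u _ => (F (t - s)).map_smul_of_tower _ _

/-- This is `F * (k * h) = k * (F * h)`: both are integrals over the same triangle, matched by
reflecting the inner variable. -/
theorem operator_conv_kernel_comm [CompleteSpace X] {k : ℝ → ℝ}
    (hk : ∀ a b, IntervalIntegrable k volume a b)
    {F : ℝ → X →L[𝕜] X} (hF : ∀ x, Continuous fun t => F t x) {h : ℝ → X} (hh : Continuous h)
    {t : ℝ} (ht : 0 ≤ t) :
    ∫ s in (0 : ℝ)..t, F (t - s) (∫ u in (0 : ℝ)..s, k (s - u) • h u) =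
      ∫ s in (0 : ℝ)..t, k (t - s) • ∫ u in (0 : ℝ)..s, F (s - u) (h u) := by
  have hF' := continuous_uncurry_of_strongly_continuous hF
  rw [operator_conv_kernel_conv hk hF hh ht]
  have hc : Continuous fun p : ℝ × ℝ => F (p.1 - p.2) (h p.2) :=
    hF'.comp (f := fun p : ℝ × ℝ => (p.1 - p.2, h p.2)) (by fun_prop)
  have h2 := integral_triangle_swap ht (φ := fun s u => k (t - s) • F (s - u) (h u))
    (integrableOn_kernel_fst_smul hk hc ht)
  simp only [intervalIntegral.integral_smul] at h2
  rw [h2]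
  refine intervalIntegral.integral_congr fun u _ => ?_
  -- The reflection `s ↦ t + u - s` of `[u, t]` exchanges `s - u` and `t - s`.
  have := intervalIntegral.integral_comp_sub_left (a := u) (b := t)
    (fun s => k (s - u) • F (t - s) (h u)) (t + u)
  simp only [add_sub_cancel_left, add_sub_cancel_right] at this
  rw [← this]
  refine intervalIntegral.integral_congr fun s _ => ?_
  congr 2
  · ring
  · congr 1; ring

end Operators

end FractionalResolvent

namespace FractionalResolvent

/-! ### Calculus of the kernels `g_β` -/

section Kernel

theorem intervalIntegrable_fracKernel {β : ℝ} (hβ : 0 < β) (a b : ℝ) :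
    IntervalIntegrable (fracKernel β) volume a b :=
  (intervalIntegral.intervalIntegrable_rpow' (by linarith)).div_const _

theorem continuous_fracKernel {β : ℝ} (hβ : 1 ≤ β) : Continuous (fracKernel β) :=
  (Real.continuous_rpow_const (by linarith)).div_const _

theorem integral_fracKernel {β : ℝ} (hβ : 0 < β) (t : ℝ) :
    ∫ s in (0 : ℝ)..t, fracKernel β s = fracKernel (β + 1) t := by
  simp only [fracKernel, intervalIntegral.integral_div]
  rw [integral_rpow (Or.inl (by linarith)), Real.Gamma_add_one hβ.ne']
  simp only [sub_add_cancel, add_sub_cancel_right, Real.zero_rpow hβ.ne', sub_zero]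
  rw [div_div]

theorem mul_fracKernel {β : ℝ} (hβ : 0 < β) {t : ℝ} (ht : 0 ≤ t) :
    t * fracKernel β t = β * fracKernel (β + 1) t := by
  have hΓ := (Real.Gamma_pos_of_pos hβ).ne'
  have h : t * t ^ (β - 1) = t ^ β := by
    rcases ht.eq_or_lt with rfl | ht
    · simp [Real.zero_rpow hβ.ne']
    · rw [mul_comm, ← Real.rpow_add_one ht.ne', sub_add_cancel]
  simp only [fracKernel, Real.Gamma_add_one hβ.ne', add_sub_cancel_right]
  rw [← mul_div_assoc, h]
  field_simp

variable {X : Type*} [NormedAddCommGroup X] [NormedSpace ℝ X]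

theorem continuous_fracConv {β : ℝ} (hβ : 0 < β) {f : ℝ → X} (hf : Continuous f) :
    Continuous (fracConv β f) :=
  continuous_kernel_integral (intervalIntegrable_fracKernel hβ) hf

theorem fracConv_const [CompleteSpace X] {β : ℝ} (hβ : 0 < β) (x : X) (t : ℝ) :
    fracConv β (fun _ => x) t = fracKernel (β + 1) t • x := by
  rw [fracConv, integral_kernel_comm, intervalIntegral.integral_smul_const,
    integral_fracKernel hβ]

theorem fracConv_congr {β : ℝ} {f g : ℝ → X} {t : ℝ} (ht : 0 ≤ t)
    (h : ∀ s ∈ Icc 0 t, f s = g s) : fracConv β f t = fracConv β g t := by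
  refine intervalIntegral.integral_congr fun s hs => ?_
  rw [uIcc_of_le ht] at hs
  simp only [h s hs]

theorem fracConv_add {β : ℝ} (hβ : 0 < β) {f g : ℝ → X} (hf : Continuous f) (hg : Continuous g)
    (t : ℝ) : fracConv β (fun s => f s + g s) t = fracConv β f t + fracConv β g t := by
  simp only [fracConv, smul_add]
  exact intervalIntegral.integral_add
    (intervalIntegrable_kernel_smul (intervalIntegrable_fracKernel hβ) hf _ _ _)
    (intervalIntegrable_kernel_smul (intervalIntegrable_fracKernel hβ) hg _ _ _)

theorem fracConv_sub {β : ℝ} (hβ : 0 < β) {f g : ℝ → X} (hf : Continuous f) (hg : Continuous g)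
    (t : ℝ) : fracConv β (fun s => f s - g s) t = fracConv β f t - fracConv β g t := by
  simp only [fracConv, smul_sub]
  exact intervalIntegral.integral_sub
    (intervalIntegrable_kernel_smul (intervalIntegrable_fracKernel hβ) hf _ _ _)
    (intervalIntegrable_kernel_smul (intervalIntegrable_fracKernel hβ) hg _ _ _)

theorem fracConv_smul {β : ℝ} (c : ℝ) (f : ℝ → X) (t : ℝ) :
    fracConv β (fun s => c • f s) t = c • fracConv β f t := by
  simp only [fracConv, smul_comm _ c, intervalIntegral.integral_smul]

/-- Only `g_β` may be singular: `γ ≥ 1` makes `g_γ` continuous, so that it can act as a strongly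
continuous family. -/
theorem fracConv_comm [CompleteSpace X] {β γ : ℝ} (hβ : 0 < β) (hγ : 1 ≤ γ) {f : ℝ → X}
    (hf : Continuous f) {t : ℝ} (ht : 0 ≤ t) :
    fracConv γ (fracConv β f) t = fracConv β (fracConv γ f) t :=
  operator_conv_kernel_comm (𝕜 := ℝ) (intervalIntegrable_fracKernel hβ)
    (F := fun t => fracKernel γ t • ContinuousLinearMap.id ℝ X)
    (fun _ => (continuous_fracKernel hγ).smul continuous_const) hf ht

theorem integral_fracConv [CompleteSpace X] {β : ℝ} (hβ : 0 < β) {f : ℝ → X}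
    (hf : Continuous f) {t : ℝ} (ht : 0 ≤ t) :
    ∫ s in (0 : ℝ)..t, fracConv β f s = fracConv (β + 1) f t := by
  refine (operator_conv_kernel_conv (𝕜 := ℝ) (intervalIntegrable_fracKernel hβ)
    (F := fun _ => ContinuousLinearMap.id ℝ X) (fun _ => continuous_const) hf ht).trans ?_
  refine intervalIntegral.integral_congr fun u _ => ?_
  have := intervalIntegral.integral_comp_sub_right (a := u) (b := t) (fracKernel β) u
  simp only [ContinuousLinearMap.id_apply]
  rw [intervalIntegral.integral_smul_const, this, sub_self, integral_fracKernel hβ]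

/-- Write `t = (t - s) + s` under the integral and use `(t - s) g_β(t - s) = β g_(β+1)(t - s)`. -/
theorem smul_fracConv {β : ℝ} (hβ : 0 < β) {f : ℝ → X} (hf : Continuous f) {t : ℝ}
    (ht : 0 ≤ t) :
    t • fracConv β f t = β • fracConv (β + 1) f t + fracConv β (fun s => s • f s) t := by
  have h1 : IntervalIntegrable (fun s => fracKernel (β + 1) (t - s) • β • f s) volume 0 t :=
    intervalIntegrable_kernel_smul (intervalIntegrable_fracKernel (by linarith))
      (hf.const_smul β) _ _ _
  have h2 : IntervalIntegrable (fun s => fracKernel β (t - s) • s • f s) volume 0 t :=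
    intervalIntegrable_kernel_smul (intervalIntegrable_fracKernel hβ)
      (continuous_id.smul hf) _ _ _
  rw [← fracConv_smul, ← fracConv_smul]
  simp only [fracConv]
  rw [← intervalIntegral.integral_add h1 h2]
  refine intervalIntegral.integral_congr fun s hs => ?_
  rw [uIcc_of_le ht] at hs
  have := mul_fracKernel hβ (sub_nonneg.2 hs.2)
  simp only [smul_smul, ← add_smul]
  congr 1
  linear_combination this

end Kernel

variable {𝕜 X : Type*} [RCLike 𝕜] [NormedAddCommGroup X] [NormedSpace 𝕜 X]
  [NormedSpace ℝ X] [IsScalarTower ℝ 𝕜 X] [CompleteSpace X]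

theorem exists_clm_fracConv {β : ℝ} (hβ : 0 < β) {F : ℝ → X →L[𝕜] X}
    (hF : ∀ x, Continuous fun t => F t x) (t : ℝ) :
    ∃ P : X →L[𝕜] X, ∀ x, P x = fracConv β (fun s => F s x) t := by
  have : SMulCommClass ℝ 𝕜 X := ⟨fun a b x => by
    rw [← algebraMap_smul 𝕜 a (b • x), ← algebraMap_smul 𝕜 a x, smul_comm]⟩
  -- A symmetric interval, since `t` may be negative.
  obtain ⟨C, hC⟩ := exists_norm_le_of_strongly_continuous hF (-|t|) |t|
  refine ⟨LinearMap.mkContinuous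
    { toFun := fun x => fracConv β (fun s => F s x) t
      map_add' := fun x y => by
        simp only [map_add]; exact fracConv_add hβ (hF x) (hF y) t
      map_smul' := fun c x => by
        simp only [map_smul, fracConv, RingHom.id_apply]
        rw [← intervalIntegral.integral_smul]
        simp only [smul_comm _ c] }
    |∫ s in (0 : ℝ)..t, |fracKernel β (t - s)| * C| fun x => ?_, fun x => rfl⟩
  have hint : IntervalIntegrable (fun s => |fracKernel β (t - s)| * C) volume 0 t := by
    have := (intervalIntegrable_kernel_smul (intervalIntegrable_fracKernel hβ)
      (continuous_const (y := (1 : ℝ))) t 0 t).norm.mul_const C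
    simpa using this
  have := intervalIntegral.norm_integral_le_abs_of_norm_le (μ := volume) (a := 0) (b := t)
    (f := fun s => fracKernel β (t - s) • F s x)
    (g := fun s => (|fracKernel β (t - s)| * C) * ‖x‖) ?_ (hint.mul_const _)
  · refine this.trans ?_
    rw [intervalIntegral.integral_mul_const, abs_mul, abs_norm]
  · refine (ae_restrict_iff' measurableSet_uIoc).2 (Eventually.of_forall fun s hs => ?_)
    have hs' : s ∈ Icc (-|t|) |t| := by
      rcases le_total 0 t with h | h
      · rw [uIoc_of_le h] at hs
        rw [abs_of_nonneg h]; exact ⟨by linarith [hs.1], hs.2⟩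
      · rw [uIoc_of_ge h] at hs
        rw [abs_of_nonpos h]; exact ⟨by linarith [hs.1], by linarith [hs.2]⟩
    rw [norm_smul, Real.norm_eq_abs, mul_assoc]
    exact mul_le_mul_of_nonneg_left ((F s).le_of_opNorm_le (hC s hs') x) (abs_nonneg _)

omit [IsScalarTower ℝ 𝕜 X] in
theorem continuous_operator_conv {F : ℝ → X →L[𝕜] X} (hF : ∀ x, Continuous fun t => F t x)
    {f : ℝ → X} (hf : Continuous f) :
    Continuous fun t => ∫ s in (0 : ℝ)..t, F (t - s) (f s) :=
  intervalIntegral.continuous_parametric_intervalIntegral_of_continuous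
    (f := fun t s => F (t - s) (f s)) ((continuous_uncurry_of_strongly_continuous hF).comp
      (f := fun p : ℝ × ℝ => (p.1 - p.2, f p.2)) (by fun_prop)) continuous_id

omit [NormedSpace ℝ X] [IsScalarTower ℝ 𝕜 X] in
theorem continuous_operator_conv_integrand {F : ℝ → X →L[𝕜] X}
    (hF : ∀ x, Continuous fun t => F t x) {f : ℝ → X} (hf : Continuous f) (t : ℝ) :
    Continuous fun s => F (t - s) (f s) :=
  (continuous_uncurry_of_strongly_continuous hF).comp
      (f := fun s : ℝ => (t - s, f s)) (by fun_prop)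

/-! ### Resolvent family identities: uniqueness, `t P = α P * S`, `A ∫ P = S - I` -/

section Resolvent

variable {α : ℝ} {A : X →ₗ.[𝕜] X} {S P : ℝ → X →L[𝕜] X}

namespace IsResolventFamily

variable (hS : IsResolventFamily α A S) (hSc : ∀ x, Continuous fun t => S t x)
include hS

omit [IsScalarTower ℝ 𝕜 X] [CompleteSpace X] in
theorem mem_graph {x y : X} (hxy : (x, y) ∈ A.graph) {t : ℝ} (ht : 0 ≤ t) :
    (S t x, S t y) ∈ A.graph := by
  obtain ⟨z, rfl, rfl⟩ := A.mem_graph_iff.1 hxy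
  obtain ⟨h, h'⟩ := hS.commute t ht z
  rw [← h']
  exact A.mem_graph ⟨_, h⟩

omit [IsScalarTower ℝ 𝕜 X] [CompleteSpace X] in
theorem eq_add_fracConv {x y : X} (hxy : (x, y) ∈ A.graph) {t : ℝ} (ht : 0 ≤ t) :
    S t x = x + fracConv α (fun s => S s y) t := by
  obtain ⟨z, rfl, rfl⟩ := A.mem_graph_iff.1 hxy
  exact hS.resolvent_eq z t ht

include hSc

theorem fracConv_mem_graph {β : ℝ} (hβ : 0 < β) {x y : X} (hxy : (x, y) ∈ A.graph) {t : ℝ}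
    (ht : 0 ≤ t) : (fracConv β (fun s => S s x) t, fracConv β (fun s => S s y) t) ∈ A.graph := by
  refine integral_mem_graph_of_isClosed hS.isClosed ht
    (intervalIntegrable_kernel_smul (intervalIntegrable_fracKernel hβ) (hSc x) _ _ _)
    (intervalIntegrable_kernel_smul (intervalIntegrable_fracKernel hβ) (hSc y) _ _ _)
    fun s hs => ?_
  have := A.graph.smul_mem (algebraMap ℝ 𝕜 (fracKernel β (t - s))) (hS.mem_graph hxy hs.1)
  simpa only [algebraMap_smul, Prod.smul_mk] using this

/-- On one hand `S * w = S * (g_α * v) = g_α * (S * v)`. On the other, the resolvent equation for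
each `w s` gives `S * w - 1 * w = g_α * (S * v)`. So `1 * w = 0`, and differentiation gives `w = 0`.
-/
theorem eq_zero_of_eq_fracConv (hα : 1 < α) {w v : ℝ → X} (hw : Continuous w) (hv : Continuous v)
    (hwv : ∀ t, 0 ≤ t → (w t, v t) ∈ A.graph) (h : ∀ t, 0 ≤ t → w t = fracConv α v t)
    {t : ℝ} (ht : 0 ≤ t) : w t = 0 := by
  have hk := intervalIntegrable_fracKernel (β := α) (by linarith)
  have hint : ∀ t, 0 ≤ t → ∫ s in (0 : ℝ)..t, w s = 0 := by
    intro t ht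
    have h1 : ∫ s in (0 : ℝ)..t, S (t - s) (w s)
        = ∫ s in (0 : ℝ)..t, fracKernel α (t - s) • ∫ u in (0 : ℝ)..s, S (s - u) (v u) := by
      rw [← operator_conv_kernel_comm hk hSc hv ht]
      refine intervalIntegral.integral_congr fun s hs => ?_
      rw [uIcc_of_le ht] at hs
      simp only [h s hs.1, fracConv]
    have hc : Continuous fun p : ℝ × ℝ => S (p.1 - p.2) (v p.2) :=
      (continuous_uncurry_of_strongly_continuous hSc).comp
        (f := fun p : ℝ × ℝ => (p.1 - p.2, v p.2)) (by fun_prop)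
    have h2 := integral_triangle_swap ht (φ := fun s u => fracKernel α (t - s) • S (s - u) (v u))
      (integrableOn_kernel_fst_smul hk hc ht)
    simp only [intervalIntegral.integral_smul] at h2
    have h3 : ∀ s ∈ uIcc 0 t, S (t - s) (w s) - w s
        = ∫ u in s..t, fracKernel α (t - u) • S (u - s) (v s) := by
      intro s hs
      rw [uIcc_of_le ht] at hs
      rw [hS.eq_add_fracConv (hwv s hs.1) (sub_nonneg.2 hs.2), add_sub_cancel_left, fracConv]
      have := intervalIntegral.integral_comp_sub_right (a := s) (b := t)
        (fun u => fracKernel α (t - s - u) • S u (v s)) s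
      rw [sub_self] at this
      rw [← this]
      refine intervalIntegral.integral_congr fun u _ => ?_
      congr 2
      ring
    have h4 := intervalIntegral.integral_congr (μ := volume) h3
    rw [← h2, ← h1, intervalIntegral.integral_sub
      ((continuous_operator_conv_integrand hSc hw t).intervalIntegrable _ _)
      (hw.intervalIntegrable _ _)] at h4
    simpa using h4
  rcases ht.eq_or_lt with rfl | ht
  · rw [h 0 le_rfl, fracConv, intervalIntegral.integral_same]
  · have h1 := intervalIntegral.integral_hasDerivAt_right (hw.intervalIntegrable 0 t)
      (hw.stronglyMeasurableAtFilter _ _) hw.continuousAt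
    have h2 : HasDerivAt (fun u => ∫ s in (0 : ℝ)..u, w s) 0 t := by
      refine (hasDerivAt_const t (0 : X)).congr_of_eventuallyEq ?_
      filter_upwards [lt_mem_nhds ht] with u hu using hint u hu.le
    exact h1.unique h2

omit [IsScalarTower ℝ 𝕜 X] [CompleteSpace X] hS in
theorem strongly_continuous_resolventP (hα : 1 < α) (hP : ∀ t x, P t x = resolventP α S t x)
    (x : X) : Continuous fun t => P t x := by
  simp only [hP]
  exact continuous_fracConv (by linarith) (hSc x)

theorem resolventP_mem_graph (hα : 1 < α) (hP : ∀ t x, P t x = resolventP α S t x)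
    {x y : X} (hxy : (x, y) ∈ A.graph) {t : ℝ} (ht : 0 ≤ t) : (P t x, P t y) ∈ A.graph := by
  rw [hP, hP]
  exact hS.fracConv_mem_graph hSc (by linarith) hxy ht

omit [IsScalarTower ℝ 𝕜 X] in
-- Convolve the resolvent equation with `g_(α-1)`, using `g_(α-1) * 1 = g_α` and commutation of the
-- two kernels.
theorem resolventP_eq (hα : 1 < α) (hP : ∀ t x, P t x = resolventP α S t x)
    {x y : X} (hxy : (x, y) ∈ A.graph) {t : ℝ} (ht : 0 ≤ t) :
    P t x = fracKernel α t • x + fracConv α (fun s => P s y) t := by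
  have hα' : 0 < α - 1 := by linarith
  have h1 : P t x = fracConv (α - 1) (fun s => x + fracConv α (fun s => S s y) s) t := by
    rw [hP, resolventP]
    exact fracConv_congr ht fun s hs => hS.eq_add_fracConv hxy hs.1
  rw [h1, fracConv_add hα' continuous_const (continuous_fracConv (by linarith) (hSc y)),
    fracConv_const hα', sub_add_cancel, ← fracConv_comm hα' hα.le (hSc y) ht]
  simp only [hP]
  rfl

omit [IsScalarTower ℝ 𝕜 X] in
-- Volterra equation for `t P(t) x`: multiplying `resolventP_eq` by `t` yields `α` times its
-- primitive plus the term in which `t` has moved inside.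
theorem smul_resolventP_eq (hα : 1 < α) (hP : ∀ t x, P t x = resolventP α S t x)
    {x y : X} (hxy : (x, y) ∈ A.graph) {t : ℝ} (ht : 0 ≤ t) :
    t • P t x = α • (∫ s in (0 : ℝ)..t, P s x) + fracConv α (fun s => s • P s y) t := by
  have hα' : 0 < α := by linarith
  have hPc := strongly_continuous_resolventP hSc hα hP y
  have h1 : ∫ s in (0 : ℝ)..t, P s x
      = fracKernel (α + 1) t • x + fracConv (α + 1) (fun s => P s y) t := by
    rw [← integral_fracConv hα' hPc ht, ← integral_fracKernel hα',
      ← intervalIntegral.integral_smul_const, ← intervalIntegral.integral_add]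
    · refine intervalIntegral.integral_congr fun s hs => ?_
      rw [uIcc_of_le ht] at hs
      exact hS.resolventP_eq hSc hα hP hxy hs.1
    · exact ((continuous_fracKernel hα.le).smul continuous_const).intervalIntegrable _ _
    · exact (continuous_fracConv hα' hPc).intervalIntegrable _ _
  rw [h1, hS.resolventP_eq hSc hα hP hxy ht, smul_add, smul_fracConv hα' hPc ht, smul_smul,
    mul_fracKernel hα' ht, smul_add, smul_smul, add_assoc]

/-- Times `α`, this is the same Volterra equation for `α P * S`; it comes from inserting the
resolvent equation for `S s x`. -/
theorem resolventP_conv_eq (hα : 1 < α) (hP : ∀ t x, P t x = resolventP α S t x)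
    {x y : X} (hxy : (x, y) ∈ A.graph) {t : ℝ} (ht : 0 ≤ t) :
    ∫ s in (0 : ℝ)..t, P (t - s) (S s x) = (∫ s in (0 : ℝ)..t, P s x) +
      fracConv α (fun s => ∫ u in (0 : ℝ)..s, P (s - u) (S u y)) t := by
  have hα' : 0 < α := by linarith
  have hPc := strongly_continuous_resolventP hSc hα hP
  have h1 : ∫ s in (0 : ℝ)..t, P s x = ∫ s in (0 : ℝ)..t, P (t - s) x := by
    simp [intervalIntegral.integral_comp_sub_left (fun s => P s x) t]
  rw [h1, fracConv, ← operator_conv_kernel_comm (intervalIntegrable_fracKernel hα') hPc (hSc y) ht,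
    ← intervalIntegral.integral_add]
  · refine intervalIntegral.integral_congr fun s hs => ?_
    rw [uIcc_of_le ht] at hs
    rw [hS.eq_add_fracConv hxy hs.1, map_add, fracConv]
  · exact (continuous_operator_conv_integrand hPc continuous_const t).intervalIntegrable _ _
  · exact (continuous_operator_conv_integrand hPc
      (continuous_fracConv hα' (hSc y)) t).intervalIntegrable _ _

omit [IsScalarTower ℝ 𝕜 X] [CompleteSpace X] hSc in
theorem dense_graph_domain : Dense {x : X | ∃ y, (x, y) ∈ A.graph} := by
  convert hS.dense_domain using 1
  ext x
  exact (LinearPMap.mem_domain_iff (f := A)).symm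

theorem smul_resolventP_eq_conv (hα : 1 < α) (hP : ∀ t x, P t x = resolventP α S t x)
    (x : X) {t : ℝ} (ht : 0 ≤ t) :
    t • P t x = α • ∫ s in (0 : ℝ)..t, P (t - s) (S s x) := by
  have hα' : 0 < α := by linarith
  have hPc := strongly_continuous_resolventP hSc hα hP
  have hcont : Continuous fun x => ∫ s in (0 : ℝ)..t, P (t - s) (S s x) := by
    refine intervalIntegral.continuous_parametric_intervalIntegral_of_continuous'
      (f := fun x s => P (t - s) (S s x)) ?_ _ _
    have h1 := (continuous_uncurry_of_strongly_continuous hSc).comp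
      (f := fun p : X × ℝ => (p.2, p.1)) (by fun_prop)
    exact (continuous_uncurry_of_strongly_continuous hPc).comp
      (f := fun p : X × ℝ => (t - p.2, S p.2 p.1))
        (Continuous.prodMk (by fun_prop) h1)
  -- Both sides are continuous in `x`, so `x ∈ D(A)` suffices.
  refine congrFun (Continuous.ext_on (hS.dense_graph_domain)
    ((P t).continuous.const_smul t) (hcont.const_smul α) ?_) x
  rintro x ⟨y, hxy⟩
  have hc : ∀ z, Continuous fun t => α • ∫ s in (0 : ℝ)..t, P (t - s) (S s z) := fun z =>
    (continuous_operator_conv hPc (hSc z)).const_smul α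
  have hc' : ∀ z, Continuous fun t : ℝ => t • P t z := fun z => continuous_id.smul (hPc z)
  refine sub_eq_zero.1 (hS.eq_zero_of_eq_fracConv hSc hα
    (w := fun t => t • P t x - α • ∫ s in (0 : ℝ)..t, P (t - s) (S s x))
    (v := fun t => t • P t y - α • ∫ s in (0 : ℝ)..t, P (t - s) (S s y))
    ((hc' x).sub (hc x)) ((hc' y).sub (hc y)) ?_ ?_ ht)
  · intro t ht
    have h1 := A.graph.smul_mem (algebraMap ℝ 𝕜 t) (hS.resolventP_mem_graph hSc hα hP hxy ht)
    have h2 := integral_mem_graph_of_isClosed hS.isClosed ht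
      ((continuous_operator_conv_integrand hPc (hSc x) t).intervalIntegrable 0 t)
      ((continuous_operator_conv_integrand hPc (hSc y) t).intervalIntegrable 0 t)
      fun s hs => hS.resolventP_mem_graph hSc hα hP (hS.mem_graph hxy hs.1) (sub_nonneg.2 hs.2)
    have h3 := A.graph.sub_mem h1 (A.graph.smul_mem (algebraMap ℝ 𝕜 α) h2)
    simpa only [algebraMap_smul, Prod.smul_mk, Prod.mk_sub_mk] using h3
  · intro t ht
    rw [fracConv_sub hα' (hc' y) (hc y), fracConv_smul, hS.smul_resolventP_eq hSc hα hP hxy ht,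
      hS.resolventP_conv_eq hSc hα hP hxy ht, smul_add]
    abel

/-- Since `1 * g_(α-1) = g_α`, the integral is `(g_α * S)(t) x`; on `D(A)` the claim is the
resolvent equation, and it persists under limits in `x` because the graph is closed. -/
theorem integral_resolventP_mem_graph (hα : 1 < α) (hP : ∀ t x, P t x = resolventP α S t x)
    (x : X) {t : ℝ} (ht : 0 ≤ t) :
    (∫ s in (0 : ℝ)..t, P s x, S t x - x) ∈ A.graph := by
  have hα' : 0 < α := by linarith
  have hPc := strongly_continuous_resolventP hSc hα hP
  have hcont : Continuous fun x => (∫ s in (0 : ℝ)..t, P s x, S t x - x) := by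
    refine Continuous.prodMk ?_ (by fun_prop)
    refine intervalIntegral.continuous_parametric_intervalIntegral_of_continuous'
      (f := fun x s => P s x) ?_ _ _
    exact (continuous_uncurry_of_strongly_continuous hPc).comp
      (f := fun p : X × ℝ => (p.2, p.1)) (by fun_prop)
  have hclosed : IsClosed {x : X | (∫ s in (0 : ℝ)..t, P s x, S t x - x) ∈ A.graph} :=
    IsClosed.preimage hcont hS.isClosed
  refine hclosed.closure_subset_iff.2 ?_ (hS.dense_graph_domain x)
  rintro x ⟨y, hxy⟩
  have h1 := hS.fracConv_mem_graph hSc hα' hxy ht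
  have h2 : ∫ s in (0 : ℝ)..t, P s x = fracConv α (fun s => S s x) t := by
    simp only [hP, resolventP]
    rw [integral_fracConv (by linarith) (hSc x) ht, sub_add_cancel]
  rw [mem_ofPred_eq, h2, hS.eq_add_fracConv hxy ht, add_sub_cancel_left]
  exact h1

end IsResolventFamily

end Resolvent

end FractionalResolvent

/-! ### Bounded semivariation and Stieltjes sums -/

namespace FractionalResolvent

variable {𝕜 X : Type*} [RCLike 𝕜] [NormedAddCommGroup X] [NormedSpace 𝕜 X]

theorem HasBoundedSemivariation.exists_bound {G : ℝ → X →L[𝕜] X} {a b : ℝ}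
    (hG : HasBoundedSemivariation G a b) :
    ∃ C : ℝ, 0 ≤ C ∧ ∀ (d : Subdivision a b) (M : ℝ) (x : ℕ → X), (∀ i, ‖x i‖ ≤ M) →
      ‖∑ i ∈ Finset.range d.n, (G (d.pt (i + 1)) - G (d.pt i)) (x i)‖ ≤ C * M := by
  refine ⟨(semivariation G a b).toReal, ENNReal.toReal_nonneg, fun d M x hx => ?_⟩
  have hunit : ∀ y : ℕ → X, (∀ i, ‖y i‖ ≤ 1) →
      ‖∑ i ∈ Finset.range d.n, (G (d.pt (i + 1)) - G (d.pt i)) (y i)‖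
        ≤ (semivariation G a b).toReal := by
    intro y hy
    have h1 : ‖∑ i ∈ Finset.range d.n, (G (d.pt (i + 1)) - G (d.pt i)) (y i)‖ₑ
        ≤ semivariation G a b :=
      (le_iSup₂ (f := fun (x : ℕ → X) (_ : ∀ i, ‖x i‖ ≤ 1) =>
        ‖∑ i ∈ Finset.range d.n, (G (d.pt (i + 1)) - G (d.pt i)) (x i)‖ₑ) y hy).trans
        (le_iSup (fun d => semivariationOn G d) d)
    simpa using ENNReal.toReal_mono hG.ne h1
  have hM : 0 ≤ M := (norm_nonneg _).trans (hx 0)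
  rcases hM.eq_or_lt with rfl | hM
  · have : ∀ i, x i = 0 := fun i => norm_le_zero_iff.1 (hx i)
    simp [this]
  · have h := hunit (fun i => ((M⁻¹ : ℝ) : 𝕜) • x i) fun i => by
      rw [norm_smul, RCLike.norm_ofReal, abs_of_pos (inv_pos.2 hM), inv_mul_le_iff₀ hM, mul_one]
      exact hx i
    simp only [map_smul, ← Finset.smul_sum] at h
    rw [norm_smul, RCLike.norm_ofReal, abs_of_pos (inv_pos.2 hM), inv_mul_le_iff₀ hM] at h
    linarith

/-- A function constant on coarse cells has the same Stieltjes sum on the refined partition. -/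
theorem sum_range_mul_telescope (B : ℕ → X →L[𝕜] X) (y : ℕ → X) {m : ℕ} (hm : 0 < m) (n : ℕ) :
    ∑ j ∈ Finset.range (n * m), (B (j + 1) - B j) (y (j / m)) =
      ∑ i ∈ Finset.range n, (B ((i + 1) * m) - B (i * m)) (y i) := by
  induction n with
  | zero => simp
  | succ n ih =>
    rw [Finset.sum_range_succ, ← ih, add_mul, one_mul, Finset.sum_range_add]
    congr 1
    have h : ∀ j ∈ Finset.range m, (B (n * m + j + 1) - B (n * m + j)) (y ((n * m + j) / m))
        = (B (n * m + (j + 1)) (y n) - B (n * m + j) (y n)) := by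
      intro j hj
      rw [mul_comm n m, Nat.mul_add_div hm, Nat.div_eq_of_lt (Finset.mem_range.1 hj), add_zero,
        _root_.sub_apply]
      rfl
    rw [Finset.sum_congr rfl h, Finset.sum_range_sub (fun j => B (n * m + j) (y n)),
      _root_.sub_apply, add_zero]

theorem uniform_sum_bound {S : ℝ → X →L[𝕜] X} {r C : ℝ}
    (hC : ∀ (d : Subdivision 0 r) (M : ℝ) (x : ℕ → X), (∀ i, ‖x i‖ ≤ M) →
      ‖∑ i ∈ Finset.range d.n, (S (d.pt (i + 1)) - S (d.pt i)) (x i)‖ ≤ C * M)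
    {t : ℝ} (ht : 0 < t) (htr : t ≤ r) {n : ℕ} (hn : 0 < n) {M : ℝ} {y : ℕ → X} (hM : 0 ≤ M)
    (hy : ∀ i < n, ‖y i‖ ≤ M) :
    ‖∑ i ∈ Finset.range n, (S ((i + 1 : ℕ) * (t / n)) - S (i * (t / n))) (y i)‖ ≤ C * M := by
  have hn' : (0 : ℝ) < n := by exact_mod_cast hn
  have hstep : 0 < t / n := div_pos ht hn'
  -- The zero at index `n` also kills the cell `[t, r]` added below when `t < r`.
  have hy' : ∀ i, ‖if i < n then y i else 0‖ ≤ M := by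
    intro i; split_ifs with h
    · exact hy i h
    · simpa using hM
  have hlt : ∀ i : ℕ, (i : ℝ) * (t / n) < (i + 1 : ℕ) * (t / n) := fun i => by
    push_cast; linarith
  have hlast : (n : ℝ) * (t / n) = t := by field_simp
  rcases htr.eq_or_lt with rfl | htr
  · have h := hC ⟨n, fun i => i * (t / n), by simp, hlast, fun i _ => hlt i⟩ M _ hy'
    refine le_of_eq_of_le (congrArg _ (Finset.sum_congr rfl fun i hi => ?_)) h
    rw [if_pos (Finset.mem_range.1 hi)]
  · have h := hC ⟨n + 1, fun i => if i ≤ n then i * (t / n) else r, by simp, by simp,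
      fun i hi => by
        rcases (Nat.lt_succ_iff.1 hi).eq_or_lt with rfl | hi
        · simpa [hlast] using htr
        · simpa only [if_pos hi.le, if_pos (Nat.succ_le_of_lt hi)] using hlt i⟩ M _ hy'
    refine le_of_eq_of_le (congrArg _ ?_) h
    rw [Finset.sum_range_succ, if_neg (lt_irrefl n), map_zero, add_zero]
    refine Finset.sum_congr rfl fun i hi => ?_
    have hi := Finset.mem_range.1 hi
    simp only [if_pos hi, if_pos hi.le, if_pos (Nat.succ_le_of_lt hi)]

variable [NormedSpace ℝ X] [IsScalarTower ℝ 𝕜 X] [CompleteSpace X]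
  {α : ℝ} {A : X →ₗ.[𝕜] X} {S P : ℝ → X →L[𝕜] X}

omit [IsScalarTower ℝ 𝕜 X] in
theorem tendsto_sum_integral_mesh (hPc : ∀ x, Continuous fun t => P t x) {g : ℝ → X}
    (hg : Continuous g) {t : ℝ} (ht : 0 < t) :
    Tendsto (fun n : ℕ => ∑ i ∈ Finset.range (n + 1),
      ∫ u in ((i : ℝ) * (t / (n + 1 : ℕ)))..((i + 1 : ℕ) * (t / (n + 1 : ℕ))),
        P u (g (i * (t / (n + 1 : ℕ))))) atTop (𝓝 (∫ u in (0 : ℝ)..t, P u (g u))) := by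
  have hPu := continuous_uncurry_of_strongly_continuous hPc
  obtain ⟨C, hC⟩ := exists_norm_le_of_strongly_continuous hPc 0 t
  have hC0 : 0 ≤ C := (norm_nonneg _).trans (hC 0 ⟨le_rfl, ht.le⟩)
  have huc := isCompact_Icc.uniformContinuousOn_of_continuous (hg.continuousOn (s := Icc 0 t))
  rw [Metric.uniformContinuousOn_iff_le] at huc
  rw [Metric.tendsto_atTop]
  intro ε hε
  -- The cell errors add up to at most `C * t` times this, which is less than `ε`; the `+ 1` avoids
  -- dividing by zero.
  obtain ⟨δ, hδ, hgδ⟩ := huc (ε / (2 * (C * t + 1))) (by positivity)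
  have hlim : Tendsto (fun n : ℕ => t / ((n + 1 : ℕ) : ℝ)) atTop (𝓝 0) :=
    (tendsto_const_div_atTop_nhds_zero_nat t).comp (tendsto_add_atTop_nat 1)
  obtain ⟨N, hN⟩ := eventually_atTop.1 (hlim.eventually (gt_mem_nhds hδ))
  refine ⟨N, fun n hn => ?_⟩
  have hmesh := hN n hn
  set h := t / ((n + 1 : ℕ) : ℝ) with hh
  have hpos : 0 < h := by positivity
  have hlast : ((n + 1 : ℕ) : ℝ) * h = t := by rw [hh]; field_simp
  have hmain : Continuous fun u => P u (g u) := hPu.comp (continuous_id.prodMk hg)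
  have hsum := intervalIntegral.sum_integral_adjacent_intervals (f := fun u => P u (g u))
    (μ := volume) (a := fun i : ℕ => (i : ℝ) * h) (n := n + 1)
    fun k _ => hmain.intervalIntegrable _ _
  simp only [hlast, Nat.cast_zero, zero_mul] at hsum
  rw [dist_eq_norm, ← hsum, ← Finset.sum_sub_distrib]
  have hterm : ∀ i ∈ Finset.range (n + 1),
      ‖(∫ u in ((i : ℝ) * h)..((i + 1 : ℕ) * h), P u (g (i * h))) -
        ∫ u in ((i : ℝ) * h)..((i + 1 : ℕ) * h), P u (g u)‖
        ≤ C * (ε / (2 * (C * t + 1))) * h := by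
    intro i hi
    have hi' : ((i + 1 : ℕ) : ℝ) ≤ (n + 1 : ℕ) := by
      exact_mod_cast Finset.mem_range.1 hi
    have hle : ((i + 1 : ℕ) : ℝ) * h ≤ t := by rw [← hlast]; gcongr
    have hi0 : 0 ≤ (i : ℝ) * h := by positivity
    have hstep : ((i + 1 : ℕ) : ℝ) * h = i * h + h := by push_cast; ring
    rw [← intervalIntegral.integral_sub ((hPc _).intervalIntegrable _ _)
      (hmain.intervalIntegrable _ _)]
    refine (intervalIntegral.norm_integral_le_of_norm_le_const
      (C := C * (ε / (2 * (C * t + 1)))) fun u hu => ?_).trans_eq ?_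
    · rw [uIoc_of_le (by linarith)] at hu
      have hu' : u ∈ Icc 0 t := ⟨by linarith [hu.1], by linarith [hu.2]⟩
      rw [← map_sub]
      refine ((P u).le_of_opNorm_le (hC u hu') _).trans ?_
      gcongr
      rw [← dist_eq_norm]
      refine hgδ _ ⟨hi0, by linarith⟩ _ hu' ?_
      rw [Real.dist_eq, abs_le]
      constructor <;> linarith [hu.1, hu.2]
    · rw [hstep, add_sub_cancel_left, abs_of_pos hpos]
  refine (norm_sum_le_of_le _ hterm).trans_lt ?_
  rw [Finset.sum_const, Finset.card_range, nsmul_eq_mul, mul_left_comm, hlast]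
  have h1 : C * (ε / (2 * (C * t + 1))) * t = ε * (C * t / (2 * (C * t + 1))) := by ring
  have h2 : C * t / (2 * (C * t + 1)) < 1 := by
    rw [div_lt_one (by positivity)]; nlinarith [mul_nonneg hC0 ht.le]
  rw [h1]
  nlinarith

omit [NormedSpace ℝ X] [IsScalarTower ℝ 𝕜 X] [CompleteSpace X] in
-- On the refinement the two sums differ only in the points where `g` is evaluated, at distance at
-- most one coarse mesh; the difference is a Stieltjes sum of vectors of norm at most `ε`.
theorem norm_sum_sub_sum_refine_le {r C : ℝ}
    (hC : ∀ (d : Subdivision 0 r) (M : ℝ) (x : ℕ → X), (∀ i, ‖x i‖ ≤ M) →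
      ‖∑ i ∈ Finset.range d.n, (S (d.pt (i + 1)) - S (d.pt i)) (x i)‖ ≤ C * M)
    {t : ℝ} (ht : 0 < t) (htr : t ≤ r) {g : ℝ → X} {ε δ : ℝ} (hε : 0 ≤ ε)
    (hg : ∀ u ∈ Icc 0 t, ∀ v ∈ Icc 0 t, dist u v ≤ δ → dist (g u) (g v) ≤ ε) {n m : ℕ}
    (hn : 0 < n) (hm : 0 < m) (hmesh : t / n ≤ δ) :
    ‖(∑ i ∈ Finset.range n, (S ((i + 1 : ℕ) * (t / n)) - S (i * (t / n))) (g (i * (t / n)))) -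
      ∑ j ∈ Finset.range (n * m), (S ((j + 1 : ℕ) * (t / (n * m : ℕ))) -
        S (j * (t / (n * m : ℕ)))) (g (j * (t / (n * m : ℕ))))‖ ≤ C * ε := by
  have hn' : (0 : ℝ) < n := by exact_mod_cast hn
  have hm' : (0 : ℝ) < m := by exact_mod_cast hm
  set h := t / ((n * m : ℕ) : ℝ) with hh
  have hpos : 0 < h := by rw [hh]; push_cast; positivity
  have hnm : t / n = m * h := by rw [hh]; push_cast; field_simp
  have hlast : (n : ℝ) * (m * h) = t := by rw [← hnm]; field_simp
  have htel := sum_range_mul_telescope (fun j => S (j * h)) (fun i => g (i * (t / n))) hm n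
  have hcoarse : ∑ i ∈ Finset.range n,
      (S ((i + 1 : ℕ) * (t / n)) - S (i * (t / n))) (g (i * (t / n))) =
      ∑ j ∈ Finset.range (n * m), (S ((j + 1 : ℕ) * h) - S (j * h))
        (g ((j / m : ℕ) * (t / n))) := by
    rw [htel]
    refine Finset.sum_congr rfl fun i _ => ?_
    simp only [hnm, Nat.cast_mul, mul_assoc]
  rw [hcoarse, ← Finset.sum_sub_distrib]
  simp only [← map_sub]
  refine uniform_sum_bound hC ht htr (Nat.mul_pos hn hm) hε fun j hj => ?_
  rw [← dist_eq_norm, hnm]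
  have h1 : ((j / m : ℕ) : ℝ) * m ≤ j := by exact_mod_cast Nat.div_mul_le_self j m
  have h2 : (j : ℝ) ≤ (j / m : ℕ) * m + m := by
    exact_mod_cast (Nat.lt_div_mul_add hm).le
  have h3 : (j : ℝ) ≤ n * m := by exact_mod_cast hj.le
  have h1' := mul_le_mul_of_nonneg_right h1 hpos.le
  have h2' := mul_le_mul_of_nonneg_right h2 hpos.le
  have h3' := mul_le_mul_of_nonneg_right h3 hpos.le
  have h4 : (0 : ℝ) ≤ (j / m : ℕ) * (m * h) := by positivity
  have h5 : (0 : ℝ) ≤ j * h := by positivity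
  refine hg _ ⟨h4, by linarith⟩ _ ⟨h5, by linarith⟩ ?_
  rw [Real.dist_eq, abs_le]
  rw [hnm] at hmesh
  constructor <;> linarith

theorem IsResolventFamily.integral_resolventP_apply_mem_graph (hS : IsResolventFamily α A S)
    (hSc : ∀ x, Continuous fun t => S t x)
    (hα : 1 < α) (hP : ∀ t x, P t x = resolventP α S t x) {r C : ℝ} (hC0 : 0 ≤ C)
    (hC : ∀ (d : Subdivision 0 r) (M : ℝ) (x : ℕ → X), (∀ i, ‖x i‖ ≤ M) →
      ‖∑ i ∈ Finset.range d.n, (S (d.pt (i + 1)) - S (d.pt i)) (x i)‖ ≤ C * M)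
    {t : ℝ} (ht : 0 < t) (htr : t ≤ r) {g : ℝ → X} (hg : Continuous g) {M : ℝ}
    (hM : ∀ u ∈ Icc 0 t, ‖g u‖ ≤ M) :
    ∃ z, (∫ u in (0 : ℝ)..t, P u (g u), z) ∈ A.graph ∧ ‖z‖ ≤ C * M := by
  have hPc := strongly_continuous_resolventP hSc hα hP
  have hM0 : 0 ≤ M := (norm_nonneg _).trans (hM 0 ⟨le_rfl, ht.le⟩)
  let T : ℕ → X := fun n => ∑ i ∈ Finset.range n,
    (S ((i + 1 : ℕ) * (t / n)) - S (i * (t / n))) (g (i * (t / n)))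
  have hTle : ∀ n, ‖T (n + 1)‖ ≤ C * M := fun n => by
    refine uniform_sum_bound hC ht htr n.succ_pos hM0 fun i hi => hM _ ⟨by positivity, ?_⟩
    have hi' : (i : ℝ) ≤ (n + 1 : ℕ) := by exact_mod_cast hi.le
    calc (i : ℝ) * (t / (n + 1 : ℕ)) ≤ (n + 1 : ℕ) * (t / (n + 1 : ℕ)) := by gcongr
      _ = t := by field_simp
  have hcauchy : CauchySeq fun n => T (n + 1) := by
    have huc := isCompact_Icc.uniformContinuousOn_of_continuous (hg.continuousOn (s := Icc 0 t))
    rw [Metric.uniformContinuousOn_iff_le] at huc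
    rw [Metric.cauchySeq_iff']
    intro ε hε
    obtain ⟨δ, hδ, hgδ⟩ := huc (ε / (2 * C + 1)) (by positivity)
    have hlim : Tendsto (fun n : ℕ => t / ((n + 1 : ℕ) : ℝ)) atTop (𝓝 0) :=
      (tendsto_const_div_atTop_nhds_zero_nat t).comp (tendsto_add_atTop_nat 1)
    obtain ⟨N, hN⟩ := eventually_atTop.1 (hlim.eventually (gt_mem_nhds hδ))
    refine ⟨N, fun n hn => ?_⟩
    -- The partitions into `n + 1` and `N + 1` cells are both compared with their common refinement
    -- into `(n + 1) * (N + 1)` cells.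
    have h1 := norm_sum_sub_sum_refine_le hC ht htr (by positivity) hgδ n.succ_pos N.succ_pos
      (hN n hn).le
    have h2 := norm_sum_sub_sum_refine_le hC ht htr (by positivity) hgδ N.succ_pos n.succ_pos
      (hN N le_rfl).le
    rw [mul_comm N.succ n.succ] at h2
    change ‖T (n + 1) - T ((n + 1) * (N + 1))‖ ≤ _ at h1
    change ‖T (N + 1) - T ((n + 1) * (N + 1))‖ ≤ _ at h2
    rw [dist_eq_norm]
    calc ‖T (n + 1) - T (N + 1)‖
        = ‖(T (n + 1) - T ((n + 1) * (N + 1))) - (T (N + 1) - T ((n + 1) * (N + 1)))‖ := by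
          congr 1; abel
      _ ≤ C * (ε / (2 * C + 1)) + C * (ε / (2 * C + 1)) := (norm_sub_le _ _).trans (add_le_add h1 h2)
      _ = ε * (2 * C / (2 * C + 1)) := by ring
      _ < ε * 1 := by
          gcongr
          rw [div_lt_one (by positivity)]; linarith
      _ = ε := mul_one ε
  obtain ⟨z, hz⟩ := cauchySeq_tendsto_of_complete hcauchy
  refine ⟨z, ?_, le_of_tendsto hz.norm (Eventually.of_forall hTle)⟩
  refine hS.isClosed.mem_of_tendsto ((tendsto_sum_integral_mesh hPc hg ht).prodMk_nhds hz)
    (Eventually.of_forall fun n => ?_)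
  have hterm : ∀ i ∈ Finset.range (n + 1),
      ((∫ u in ((i : ℝ) * (t / (n + 1 : ℕ)))..((i + 1 : ℕ) * (t / (n + 1 : ℕ))),
        P u (g (i * (t / (n + 1 : ℕ)))),
      (S ((i + 1 : ℕ) * (t / (n + 1 : ℕ))) - S (i * (t / (n + 1 : ℕ))))
        (g (i * (t / (n + 1 : ℕ))))) : X × X) ∈ A.graph := by
    intro i _
    set y := g (i * (t / (n + 1 : ℕ)))
    have h1 := hS.integral_resolventP_mem_graph hSc hα hP y
      (t := (i + 1 : ℕ) * (t / (n + 1 : ℕ))) (by positivity)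
    have h2 := hS.integral_resolventP_mem_graph hSc hα hP y
      (t := i * (t / (n + 1 : ℕ))) (by positivity)
    have h3 := A.graph.sub_mem h1 h2
    rw [Prod.mk_sub_mk, sub_sub_sub_cancel_right, intervalIntegral.integral_interval_sub_left
      ((hPc y).intervalIntegrable _ _) ((hPc y).intervalIntegrable _ _)] at h3
    exact h3
  have := A.graph.sum_mem hterm
  exact (congrArg (· ∈ A.graph) (Prod.ext Prod.fst_sum Prod.snd_sum)).mp this

theorem IsResolventFamily.exists_clm_comp_resolventP (hS : IsResolventFamily α A S)
    (hSc : ∀ x, Continuous fun t => S t x) (hα : 1 < α) {r : ℝ}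
    (hSV : HasBoundedSemivariation S 0 r) :
    ∃ K : ℝ, ∀ t ∈ Icc 0 r, ∃ B : X →L[𝕜] X,
      (∀ x, (resolventP α S t x, B x) ∈ A.graph) ∧ ‖(t : 𝕜) • B‖ ≤ K := by
  have hα' : 0 < α := by linarith
  choose P hP using fun t => exists_clm_fracConv (β := α - 1) (by linarith) hSc t
  have hP : ∀ t x, P t x = resolventP α S t x := hP
  have hPc := strongly_continuous_resolventP hSc hα hP
  obtain ⟨C, hC0, hC⟩ := hSV.exists_bound
  obtain ⟨M, hM⟩ := exists_norm_le_of_strongly_continuous hSc 0 r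
  have hbound : ∀ t ∈ Ioc 0 r, ∀ x, ∃ z, (P t x, z) ∈ A.graph ∧
      ‖z‖ ≤ t⁻¹ * (α * (C * M)) * ‖x‖ := by
    intro t ht x
    obtain ⟨z, hz, hzle⟩ := hS.integral_resolventP_apply_mem_graph hSc hα hP hC0 hC ht.1 ht.2
      (g := fun u => S (t - u) x) ((hSc x).comp (by fun_prop)) (M := M * ‖x‖)
      fun u hu => (S (t - u)).le_of_opNorm_le
        (hM _ ⟨by linarith [hu.2], by linarith [hu.1, ht.2]⟩) x
    refine ⟨(t⁻¹ * α) • z, ?_, ?_⟩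
    · have h1 : P t x = (t⁻¹ * α) • ∫ u in (0 : ℝ)..t, P u (S (t - u) x) := by
        have h2 := intervalIntegral.integral_comp_sub_left (a := 0) (b := t)
          (fun u => P u (S (t - u) x)) t
        simp only [sub_sub_cancel, sub_self, sub_zero] at h2
        rw [← h2, mul_smul, ← hS.smul_resolventP_eq_conv hSc hα hP x ht.1.le,
          inv_smul_smul₀ ht.1.ne']
      have h3 := A.graph.smul_mem (algebraMap ℝ 𝕜 (t⁻¹ * α)) hz
      rw [h1]
      simpa only [algebraMap_smul, Prod.smul_mk] using h3
    · have h0 : 0 < t⁻¹ * α := mul_pos (inv_pos.2 ht.1) hα'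
      rw [norm_smul, Real.norm_eq_abs, abs_of_pos h0]
      calc t⁻¹ * α * ‖z‖ ≤ t⁻¹ * α * (C * (M * ‖x‖)) := by gcongr
        _ = _ := by ring
  refine ⟨|α * (C * M)|, fun t ht => ?_⟩
  rcases ht.1.eq_or_lt with rfl | ht0
  -- At `t = 0` the operator `P` vanishes, so `B = 0` serves.
  · refine ⟨0, fun x => ?_, by rw [smul_zero, norm_zero]; exact abs_nonneg _⟩
    have : resolventP α S 0 x = 0 := intervalIntegral.integral_same
    rw [this]
    exact A.graph.zero_mem
  have hdom : ∀ x, P t x ∈ A.domain := fun x => by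
    obtain ⟨z, hz, -⟩ := hbound t ⟨ht0, ht.2⟩ x
    exact LinearPMap.mem_domain_of_mem_graph hz
  let B : X →ₗ[𝕜] X := A.toFun ∘ₗ (P t : X →ₗ[𝕜] X).codRestrict A.domain hdom
  have hB : ∀ x, (P t x, B x) ∈ A.graph := fun x => A.mem_graph ⟨P t x, hdom x⟩
  have hBle : ∀ x, ‖B x‖ ≤ t⁻¹ * (α * (C * M)) * ‖x‖ := fun x => by
    obtain ⟨z, hz, hzle⟩ := hbound t ⟨ht0, ht.2⟩ x
    rwa [LinearPMap.mem_graph_snd_inj A (hB x) hz rfl]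
  refine ⟨B.mkContinuous _ hBle, fun x => hP t x ▸ hB x, ?_⟩
  refine ContinuousLinearMap.opNorm_le_bound _ (abs_nonneg _) fun x => ?_
  rw [_root_.smul_apply, norm_smul, RCLike.norm_ofReal, abs_of_pos ht0]
  calc t * ‖B x‖ ≤ t * (t⁻¹ * (α * (C * M)) * ‖x‖) := by gcongr; exact hBle x
    _ = α * (C * M) * ‖x‖ := by field_simp
    _ ≤ _ := by gcongr; exact le_abs_self _

omit [IsScalarTower ℝ 𝕜 X] [CompleteSpace X] in
-- Freezing `S` at negative times gives strong continuity on all of `ℝ`, as the convolution lemmas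
-- require, without changing anything on `[0, ∞)`.
theorem IsResolventFamily.comp_max (hS : IsResolventFamily α A S) :
    IsResolventFamily α A fun t => S (max t 0) where
  isClosed := hS.isClosed
  dense_domain := hS.dense_domain
  strongly_continuous x := (hS.strongly_continuous x).congr fun t ht => by
    simp only [max_eq_left (mem_Ici.1 ht)]
  map_zero := by simp only [max_self, hS.map_zero]
  commute t _ x := hS.commute (max t 0) (le_max_right _ _) x
  resolvent_eq x t ht := by
    simp only [max_eq_left ht]
    rw [hS.resolvent_eq x t ht]
    congr 1
    exact fracConv_congr ht fun s hs => by simp only [max_eq_left hs.1]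

theorem Subdivision.le_pt {a b : ℝ} (d : Subdivision a b) {i : ℕ} (hi : i ≤ d.n) :
    a ≤ d.pt i := by
  induction i with
  | zero => exact d.pt_zero.ge
  | succ i ih => exact (ih (by omega)).trans (d.pt_lt i (by omega)).le

omit [NormedSpace ℝ X] [IsScalarTower ℝ 𝕜 X] [CompleteSpace X] in
theorem semivariation_comp_max (S : ℝ → X →L[𝕜] X) (r : ℝ) :
    semivariation (fun t => S (max t 0)) 0 r = semivariation S 0 r := by
  refine iSup_congr fun d => iSup_congr fun x => iSup_congr fun _ => ?_
  congr 1
  refine Finset.sum_congr rfl fun i hi => ?_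
  have hi := Finset.mem_range.1 hi
  simp only [max_eq_left (d.le_pt hi.le), max_eq_left (d.le_pt (Nat.succ_le_of_lt hi))]

end FractionalResolvent

theorem mainTheorem3 {𝕜 X : Type*} [RCLike 𝕜] [NormedAddCommGroup X] [NormedSpace 𝕜 X]
    [NormedSpace ℝ X] [IsScalarTower ℝ 𝕜 X] [CompleteSpace X]
    (α : ℝ) (hα₁ : 1 < α) (hα₂ : α < 2)
    (A : X →ₗ.[𝕜] X) (S : ℝ → X →L[𝕜] X)
    (hS : FractionalResolvent.IsResolventFamily α A S)
    (r : ℝ) (hr : 0 < r)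
    (hSV : FractionalResolvent.HasBoundedSemivariation S 0 r) :
    (∀ t ∈ Set.Icc (0 : ℝ) r,
      Set.range (FractionalResolvent.resolventP α S t) ⊆ (A.domain : Set X)) ∧
    ∃ AP : ℝ → X →L[𝕜] X,
      (∀ t ∈ Set.Icc (0 : ℝ) r, ∀ x : X,
        ∃ h : FractionalResolvent.resolventP α S t x ∈ A.domain,
          A ⟨FractionalResolvent.resolventP α S t x, h⟩ = AP t x) ∧
      BddAbove ((fun t : ℝ => ‖(t : 𝕜) • AP t‖) '' Set.Icc (0 : ℝ) r) := by
  have hSc : ∀ x, Continuous fun t => S (max t 0) x := fun x =>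
    (hS.strongly_continuous x).comp_continuous (by fun_prop) fun t =>
      Set.mem_Ici.2 (le_max_right _ _)
  obtain ⟨K, hK⟩ := hS.comp_max.exists_clm_comp_resolventP hSc hα₁
    (show FractionalResolvent.semivariation _ 0 r < ⊤ by
      rw [FractionalResolvent.semivariation_comp_max]; exact hSV)
  -- Outside `[0, r]` the chosen `AP t` is arbitrary.
  choose! AP hAP hle using hK
  have hgraph : ∀ t ∈ Set.Icc (0 : ℝ) r, ∀ x,
      (FractionalResolvent.resolventP α S t x, AP t x) ∈ A.graph := fun t ht x => by
    have h : FractionalResolvent.resolventP α (fun t => S (max t 0)) t x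
        = FractionalResolvent.resolventP α S t x :=
      FractionalResolvent.fracConv_congr ht.1 fun s hs => by simp only [max_eq_left hs.1]
    exact h ▸ hAP t ht x
  have hdom : ∀ t ∈ Set.Icc (0 : ℝ) r, ∀ x, FractionalResolvent.resolventP α S t x ∈ A.domain :=
    fun t ht x => LinearPMap.mem_domain_of_mem_graph (hgraph t ht x)
  refine ⟨fun t ht => Set.range_subset_iff.2 (hdom t ht), AP, fun t ht x => ⟨hdom t ht x, ?_⟩, K, ?_⟩
  · exact LinearPMap.mem_graph_snd_inj A (A.mem_graph _) (hgraph t ht x) rfl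
  · rintro _ ⟨t, ht, rfl⟩
    exact hle t ht
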